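/- **Notation.** Let $\mathbb N=\{1,2,\dots\}$ and let $\mathcal P_n$ be the set of complex polynomials in one variable $z$ of degree at most $n$. For a compact set $E\subset\mathbb C$ and a function $g:E\to\mathbb C$ let $\|g\|_E=\sup_{z\in E}|g(z)|$, $\operatorname{dist}_E(g,\mathcal P_n)=\inf\{\|g-p\|_E: p\in\mathcal P_n\}$, and, for $\ell\in\mathbb N$, $$|g|_\ell=\|g\|_E+\sup_{n\in\mathbb N}n^\ell\operatorname{dist}_E(g,\mathcal P_n)\in[0,\infty].$$ Let $s(E)$ be the set of all continuous $g:E\to\mathbb C$ such that $\lim_{n\to\infty}n^\ell\operatorname{dist}_E(g,\mathcal P_n)=0$ for every $\ell\in\mathbb N$. Let $\mathcal H^\infty(E)$ be the set of all $f\in C^\infty(\mathbb C)$ such that $\partial f/\partial\bar z\equiv0$ in some open neighborhood of $E$, and let $E_\delta=\{z\in\mathbb C:\operatorname{dist}(z,E)\le\delta\}$ (with $E_\delta=\emptyset$ if $E=\emptyset$). A compact set $E\subset\mathbb C$ admits the *Jackson Property* $\operatorname{JP}(s)$, where $s\ge1$, if $f_{|E}\in s(E)$ for every $f\in\mathcal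 H^\infty(E)$ and there exist real constants $c,v\ge1$ such that $$\forall\,\ell\in\mathbb N\ \ \forall\,\delta\in(0,1]\ \ \forall\,f\in\mathcal H^\infty(E_\delta):\qquad |f_{|E}|_\ell\le\left(\frac{c\,\ell^{v}}{\delta^{s}}\right)^{\ell+c}\|f\|_{E_\delta}.\tag{1}$$ **Proposition.** Every compact set $E\subset\mathbb R$ (regarded as a subset of $\mathbb C$) admits $\operatorname{JP}(1)$. Moreover, estimate (1) with $s=1$ holds with $v=6$ and some constant $c\ge1$ depending only on $E$. -/

import Mathlib

open scoped ENNReal Topology ContDiff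

noncomputable section

namespace Jackson

/-- The supremum norm of a complex-valued function, with values in `[0, ∞]`
(so that no boundedness is presupposed; it is `0` on the empty set). -/
def supNorm {X : Type*} (g : X → ℂ) : ℝ≥0∞ := ⨆ x, ‖g x‖ₑ

/-- The error `dist_E(g, P_n)` of best uniform approximation on `E` of a function `g` on `E` by
holomorphic polynomials of degree at most `n`. -/
def polyDist {E : Set ℂ} (g : E → ℂ) (n : ℕ) : ℝ≥0∞ :=
  ⨅ p ∈ {p : Polynomial ℂ | p.natDegree ≤ n}, supNorm fun z : E => g z - p.eval (z : ℂ)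

/-- The Jackson norm `|g|_ℓ = ‖g‖_E + sup_{n ≥ 1} n ^ ℓ * dist_E(g, P_n)`, possibly `∞`. -/
def jacksonNorm {E : Set ℂ} (ℓ : ℕ) (g : E → ℂ) : ℝ≥0∞ :=
  supNorm g + ⨆ n ∈ {n : ℕ | 1 ≤ n}, (n : ℝ≥0∞) ^ ℓ * polyDist g n

/-- The class `s(E)` of continuous functions on `E` that are rapidly approximated by holomorphic
polynomials. -/
def rapidlyApproximable (E : Set ℂ) : Set (E → ℂ) :=
  {g | Continuous g ∧ ∀ ℓ : ℕ, 1 ≤ ℓ →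
    Filter.Tendsto (fun n : ℕ => (n : ℝ≥0∞) ^ ℓ * polyDist g n) Filter.atTop (𝓝 0)}

/-- The Wirtinger derivative `∂f/∂z̄ = (∂f/∂x + i ∂f/∂y) / 2`. -/
def dbar (f : ℂ → ℂ) (z : ℂ) : ℂ :=
  (fderiv ℝ f z 1 + Complex.I * fderiv ℝ f z Complex.I) / 2

/-- The class `H^∞(E)`: smooth functions on the whole plane whose `z̄`-derivative vanishes
identically in some open neighborhood of `E`. -/
def smoothHolomorphicNear (E : Set ℂ) : Set (ℂ → ℂ) :=
  {f | ContDiff ℝ ∞ f ∧ ∃ U : Set ℂ, IsOpen U ∧ E ⊆ U ∧ ∀ z ∈ U, dbar f z = 0}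

/-- The family of estimates in the Jackson Property with exponents `s`, `v`, for some constant
`c ≥ 1`. Here `Metric.cthickening δ E` is `E_δ = {z | dist(z, E) ≤ δ}`. -/
def JacksonEstimate (E : Set ℂ) (s v : ℝ) : Prop :=
  ∃ c : ℝ, 1 ≤ c ∧ ∀ ℓ : ℕ, 1 ≤ ℓ → ∀ δ : ℝ, 0 < δ → δ ≤ 1 →
    ∀ f ∈ smoothHolomorphicNear (Metric.cthickening δ E),
      jacksonNorm ℓ (E.domRestrict f) ≤
        ENNReal.ofReal ((c * (ℓ : ℝ) ^ v / δ ^ s) ^ ((ℓ : ℝ) + c)) *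
          supNorm ((Metric.cthickening δ E).domRestrict f)

/-- The Jackson Property `JP(s)` of a compact set `E ⊆ ℂ` (for `s ≥ 1`). -/
def JacksonProperty (E : Set ℂ) (s : ℝ) : Prop :=
  (fun f : ℂ → ℂ => E.domRestrict f) '' smoothHolomorphicNear E ⊆ rapidlyApproximable E ∧
    ∃ v : ℝ, 1 ≤ v ∧ JacksonEstimate E s v

end Jackson

end

noncomputable section

namespace Jackson

/-! Scale so that E ⊆ [-R, R] and substitute x = R cos θ: truncating a cosine series in θ at order n
gives a combination of Chebyshev polynomials, so polynomial approximation on E becomes decay of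
Fourier coefficients. Since f is controlled only near E, F(θ) = f(R cos θ) is multiplied by a cutoff
χ, equal to 1 where R cos θ ∈ E. For k = ℓ + 2, the cutoff is a k-fold moving average of a
continuous one, at scale proportional to δ/(Rk); its derivatives up to order k cost only O(Rk/δ)
each (`norm_iteratedDeriv_avg_iterate_le`). Cauchy estimates give the same growth for F
(`norm_iteratedDeriv_comp_cos_le`). Leibniz and k integrations by parts bound the m-th coefficient
by (CRk/δ)^k ‖f‖ / |m|^k, and the tail beyond n is O(n^(-ℓ)). -/

/-! ### Iterated moving averages -/

/-- The average of `u` over the interval of radius `η` around `x`. -/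
def avg (η : ℝ) (u : ℝ → ℂ) (x : ℝ) : ℂ := (2 * η : ℝ)⁻¹ • ∫ t in (-η)..η, u (x + t)

theorem hasDerivAt_avg {η : ℝ} {u : ℝ → ℂ} (hu : Continuous u) (x : ℝ) :
    HasDerivAt (avg η u) ((2 * η : ℝ)⁻¹ • (u (x + η) - u (x + -η))) x := by
  have h1 : ∀ y, ∫ t in (-η)..η, u (y + t) =
      (∫ t in (0:ℝ)..(y + η), u t) - ∫ t in (0:ℝ)..(y + -η), u t := by
    intro y
    rw [intervalIntegral.integral_comp_add_left, intervalIntegral.integral_interval_sub_left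
      (hu.intervalIntegrable _ _) (hu.intervalIntegrable _ _)]
  have h2 : ∀ s : ℝ, HasDerivAt (fun y => ∫ t in (0:ℝ)..(y + s), u t) (u (x + s)) x := by
    intro s
    have := (intervalIntegral.integral_hasDerivAt_right (hu.intervalIntegrable 0 (x + s))
      (hu.stronglyMeasurableAtFilter _ _) hu.continuousAt)
    exact HasDerivAt.comp_add_const x s this
  unfold avg
  simp_rw [h1]
  exact HasDerivAt.const_smul ((2 * η : ℝ)⁻¹) ((h2 η).sub (h2 (-η)))

theorem continuous_avg {η : ℝ} {u : ℝ → ℂ} (hu : Continuous u) : Continuous (avg η u) :=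
  continuous_iff_continuousAt.2 fun x => (hasDerivAt_avg hu x).continuousAt

theorem continuous_avg_iterate {η : ℝ} {u : ℝ → ℂ} (hu : Continuous u) (k : ℕ) :
    Continuous ((avg η)^[k] u) := by
  induction k with
  | zero => exact hu
  | succ k ih => rw [Function.iterate_succ_apply']; exact continuous_avg ih

theorem norm_avg_le {η C : ℝ} (hη : 0 < η) {u : ℝ → ℂ} (hu : ∀ x, ‖u x‖ ≤ C) (x : ℝ) :
    ‖avg η u x‖ ≤ C := by
  have := intervalIntegral.norm_integral_le_of_norm_le_const (a := -η) (b := η)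
    (f := fun t => u (x + t)) (C := C) fun t _ => hu _
  rw [avg, norm_smul, norm_inv, Real.norm_of_nonneg (by positivity), inv_mul_le_iff₀ (by positivity)]
  refine this.trans_eq ?_
  rw [abs_of_nonneg (by linarith)]
  ring

theorem norm_avg_iterate_le {η C : ℝ} (hη : 0 < η) {u : ℝ → ℂ} (hu : ∀ x, ‖u x‖ ≤ C) (k : ℕ)
    (x : ℝ) : ‖(avg η)^[k] u x‖ ≤ C := by
  induction k generalizing x with
  | zero => exact hu x
  | succ k ih => rw [Function.iterate_succ_apply']; exact norm_avg_le hη ih x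

theorem periodic_avg_iterate {η T : ℝ} {u : ℝ → ℂ} (hu : Function.Periodic u T) (k : ℕ) :
    Function.Periodic ((avg η)^[k] u) T := by
  induction k with
  | zero => exact hu
  | succ k ih =>
    rw [Function.iterate_succ_apply']
    intro x
    simp only [avg, add_right_comm x T, ih _]

/-- Each averaging looks only a distance η away, so k of them see radius kη. -/
theorem avg_iterate_eq_of_forall {η : ℝ} (hη : 0 < η) {u : ℝ → ℂ} {c : ℂ} (k : ℕ) {x : ℝ}
    (h : ∀ y, |y - x| ≤ k * η → u y = c) : (avg η)^[k] u x = c := by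
  induction k generalizing x with
  | zero => exact h x (by simp)
  | succ k ih =>
    rw [Function.iterate_succ_apply', avg]
    have : ∫ t in (-η)..η, (avg η)^[k] u (x + t) = ∫ t in (-η)..η, c := by
      refine intervalIntegral.integral_congr fun t ht => ih fun y hy => h y ?_
      rw [Set.uIcc_of_le (by linarith)] at ht
      have h1 := abs_le.2 ht
      have h2 := abs_add_le (y - (x + t)) t
      rw [show y - (x + t) + t = y - x by ring] at h2
      push_cast
      linarith
    rw [this, intervalIntegral.integral_const, smul_smul,
      show (2 * η)⁻¹ * (η - -η) = 1 by field_simp; ring, one_smul]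

theorem deriv_avg {η : ℝ} {u : ℝ → ℂ} (hu : Continuous u) :
    deriv (avg η u) = fun x => (2 * η : ℝ)⁻¹ • (u (x + η) - u (x + -η)) :=
  funext fun x => (hasDerivAt_avg hu x).deriv

theorem contDiff_avg_iterate {η : ℝ} {u : ℝ → ℂ} (hu : Continuous u) (k : ℕ) :
    ContDiff ℝ k ((avg η)^[k] u) := by
  induction k with
  | zero => exact contDiff_zero.2 hu
  | succ k ih =>
    have hc := continuous_avg_iterate (η := η) hu k
    rw [Function.iterate_succ_apply']
    push_cast
    refine contDiff_succ_iff_deriv.2 ⟨fun x => (hasDerivAt_avg hc x).differentiableAt, by simp, ?_⟩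
    rw [deriv_avg hc]
    fun_prop

/-- Each derivative uses up one averaging and turns it into a difference quotient of step 2η, of
norm at most η⁻¹ times the sup norm. No factorial appears. -/
theorem norm_iteratedDeriv_avg_iterate_le {η C : ℝ} (hη : 0 < η) {u : ℝ → ℂ} (hu : Continuous u)
    (hC : ∀ x, ‖u x‖ ≤ C) (k : ℕ) {j : ℕ} (hj : j ≤ k) (x : ℝ) :
    ‖iteratedDeriv j ((avg η)^[k] u) x‖ ≤ (η⁻¹) ^ j * C := by
  induction k generalizing j x with
  | zero =>
    obtain rfl : j = 0 := by omega
    simpa using hC x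
  | succ k ih =>
    rcases j with _ | j
    · simpa using norm_avg_iterate_le hη hC (k + 1) x
    have hjk : j ≤ k := by omega
    have hc := continuous_avg_iterate (η := η) hu k
    have hd : ContDiff ℝ j ((avg η)^[k] u) :=
      (contDiff_avg_iterate hu k).of_le (by exact_mod_cast hjk)
    have h1 : iteratedDeriv j (fun x => (2 * η : ℝ)⁻¹ •
        ((avg η)^[k] u (x + η) - (avg η)^[k] u (x + -η))) x = (2 * η : ℝ)⁻¹ •
        (iteratedDeriv j ((avg η)^[k] u) (x + η) - iteratedDeriv j ((avg η)^[k] u) (x + -η)) := by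
      rw [iteratedDeriv_fun_const_smul_field, iteratedDeriv_fun_sub (by fun_prop) (by fun_prop),
        iteratedDeriv_comp_add_const, iteratedDeriv_comp_add_const]
    rw [Function.iterate_succ_apply', iteratedDeriv_succ', deriv_avg hc, h1, norm_smul, norm_inv,
      Real.norm_of_nonneg (by positivity), inv_mul_le_iff₀ (by positivity)]
    refine (norm_sub_le _ _).trans ((add_le_add (ih hjk _) (ih hjk _)).trans_eq ?_)
    rw [pow_succ]
    field_simp
    ring

/-! ### Fourier coefficients of smooth periodic functions -/

theorem Periodic.iteratedDeriv {h : ℝ → ℂ} {T : ℝ} (hp : Function.Periodic h T) (k : ℕ) :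
    Function.Periodic (iteratedDeriv k h) T := by
  intro x
  have := congrFun (iteratedDeriv_comp_add_const k h T) x
  rw [← this]
  congr 1
  exact funext hp

/-- Integration by parts k times; periodicity kills the boundary terms. -/
theorem norm_fourierCoeffOn_le {h : ℝ → ℂ} (hp : Function.Periodic h (2 * Real.pi)) {k : ℕ}
    (hd : ContDiff ℝ k h) {B : ℝ} (hB : ∀ x, ‖iteratedDeriv k h x‖ ≤ B) {m : ℤ} (hm : m ≠ 0) :
    ‖fourierCoeffOn (lt_add_of_pos_right 0 Real.two_pi_pos) h m‖ ≤ B / |(m : ℝ)| ^ k := by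
  have hm' : 0 < |(m : ℝ)| := by positivity
  induction k generalizing h with
  | zero =>
    rw [fourierCoeffOn_eq_integral, norm_smul, pow_zero, div_one]
    have : ‖∫ x in (0:ℝ)..(0 + 2 * Real.pi),
        fourier (-m) (x : AddCircle (0 + 2 * Real.pi - 0)) • h x‖ ≤
        B * |0 + 2 * Real.pi - 0| := by
      refine intervalIntegral.norm_integral_le_of_norm_le_const fun x _ => ?_
      rw [norm_smul, fourier_apply, Circle.norm_coe, one_mul]
      simpa using hB x
    refine (mul_le_mul_of_nonneg_left this (norm_nonneg _)).trans_eq ?_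
    have := Real.pi_pos
    rw [Real.norm_of_nonneg (by simp; positivity), abs_of_nonneg (by simp; positivity)]
    field_simp
  | succ k ih =>
    push_cast at hd
    have hd' := contDiff_succ_iff_deriv.1 hd
    have h1 := ih (h := deriv h) (by simpa using Periodic.iteratedDeriv hp 1) hd'.2.2
      (fun x => by simpa [iteratedDeriv_succ'] using hB x)
    rw [fourierCoeffOn_of_hasDerivAt _ hm (fun x _ => (hd'.1 x).hasDerivAt)
      (hd'.2.2.continuous.intervalIntegrable _ _), hp 0, sub_self, mul_zero, zero_sub]
    rw [norm_mul, norm_neg, norm_mul]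
    have e1 : ‖1 / (-2 * (Real.pi : ℂ) * Complex.I * m)‖ = (2 * Real.pi * |(m : ℝ)|)⁻¹ := by
      simp [abs_of_pos Real.pi_pos]
    have e2 : ‖(((0 + 2 * Real.pi : ℝ) : ℂ) - ((0 : ℝ) : ℂ))‖ = 2 * Real.pi := by
      simp [abs_of_pos Real.pi_pos]
    rw [e1, e2]
    calc _ ≤ (2 * Real.pi * |(m : ℝ)|)⁻¹ * (2 * Real.pi * (B / |(m : ℝ)| ^ k)) := by gcongr
      _ = _ := by
        have := Real.pi_pos
        rw [pow_succ]
        field_simp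

/-- Fourier expansion of a periodic function of class `C ^ k`, with the decay of its
coefficients. -/
theorem exists_hasSum_fourier {h : ℝ → ℂ} (hp : Function.Periodic h (2 * Real.pi)) {k : ℕ}
    (hk : 2 ≤ k) (hd : ContDiff ℝ k h) {B : ℝ} (hB : ∀ x, ‖iteratedDeriv k h x‖ ≤ B) :
    ∃ a : ℤ → ℂ, (∀ m, m ≠ 0 → ‖a m‖ ≤ B / |(m : ℝ)| ^ k) ∧
      ∀ θ : ℝ, HasSum (fun m : ℤ => a m * Complex.exp (m * θ * Complex.I)) (h θ) := by
  have : Fact (0 < 2 * Real.pi) := ⟨Real.two_pi_pos⟩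
  set F : C(AddCircle (2 * Real.pi), ℂ) :=
    ⟨hp.lift, continuous_coinduced_dom.2 (by simpa using! hd.continuous)⟩ with hF
  have hco : ∀ m, fourierCoeff F m =
      fourierCoeffOn (lt_add_of_pos_right 0 Real.two_pi_pos) h m := by
    intro m
    rw [fourierCoeffOn_eq_integral, fourierCoeff_eq_intervalIntegral _ _ 0, add_sub_cancel_left]
    rfl
  have hB' : ∀ m : ℤ, m ≠ 0 → ‖fourierCoeff F m‖ ≤ B / |(m : ℝ)| ^ k := fun m hm => by
    rw [hco]; exact norm_fourierCoeffOn_le hp hd hB hm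
  have hB0 : 0 ≤ B := (norm_nonneg _).trans (hB 0)
  have hs : Summable (fourierCoeff F) := by
    have h2 : Summable fun m : ℤ => B * (1 / (m : ℝ) ^ 2) :=
      (Real.summable_one_div_int_pow.2 one_lt_two).mul_left B
    refine Summable.of_norm_bounded_eventually h2 ?_
    rw [Filter.eventually_cofinite]
    refine (Set.finite_singleton (0 : ℤ)).subset fun m hm => ?_
    by_contra hm0
    refine hm ((hB' m hm0).trans ?_)
    have hm1 : (1 : ℝ) ≤ |(m : ℝ)| := by exact_mod_cast Int.one_le_abs hm0
    rw [← sq_abs (m : ℝ), mul_one_div]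
    gcongr
  refine ⟨fourierCoeff F, hB', fun θ => ?_⟩
  have := has_pointwise_sum_fourier_series_of_summable hs (θ : AddCircle (2 * Real.pi))
  convert! this using 2 with m
  rw [smul_eq_mul, fourier_coe_apply]
  congr 2
  have : (Real.pi : ℂ) ≠ 0 := by exact_mod_cast Real.pi_ne_zero
  push_cast
  field_simp

/-! ### Derivative bounds: Cauchy and Leibniz -/

theorem iteratedDeriv_comp_ofReal {G : ℂ → ℂ} {s : Set ℂ} (hs : IsOpen s)
    (hG : DifferentiableOn ℂ G s) (k : ℕ) {x : ℝ} (hx : (x : ℂ) ∈ s) :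
    iteratedDeriv k (fun t : ℝ => G t) x = iteratedDeriv k G x := by
  induction k generalizing x with
  | zero => simp
  | succ k ih =>
    have h1 : iteratedDeriv k (fun t : ℝ => G t) =ᶠ[𝓝 x] fun t : ℝ => iteratedDeriv k G t := by
      filter_upwards [(hs.preimage Complex.continuous_ofReal).mem_nhds hx] with t ht using ih ht
    have h2 : DifferentiableAt ℂ (iteratedDeriv k G) x := by
      rw [iteratedDeriv_eq_iterate]
      exact ((hG.analyticAt (hs.mem_nhds hx)).iterated_deriv k).differentiableAt
    rw [iteratedDeriv_succ, iteratedDeriv_succ, h1.deriv_eq]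
    exact h2.hasDerivAt.comp_ofReal.deriv

theorem norm_cos_sub_cos_le (x : ℝ) {w : ℂ} (hw : ‖w - x‖ ≤ 1) :
    ‖Complex.cos w - Complex.cos x‖ ≤ 2 * ‖w - x‖ := by
  set v := w - x with hv
  have hwv : w = x + v := by rw [hv]; ring
  have e : Complex.cos w - Complex.cos x =
      (Complex.exp (x * Complex.I) * (Complex.exp (v * Complex.I) - 1) +
        Complex.exp ((-x : ℝ) * Complex.I) * (Complex.exp (-v * Complex.I) - 1)) / 2 := by
    rw [Complex.cos, Complex.cos, mul_sub, mul_sub, ← Complex.exp_add, ← Complex.exp_add, hwv]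
    push_cast
    ring_nf
  have h1 := Complex.norm_exp_sub_one_le (x := v * Complex.I) (by simpa using hw)
  have h2 := Complex.norm_exp_sub_one_le (x := -v * Complex.I) (by simpa using hw)
  simp only [norm_mul, norm_neg, Complex.norm_I, mul_one] at h1 h2
  rw [e, norm_div, Complex.norm_ofNat, div_le_iff₀ two_pos]
  refine (norm_add_le _ _).trans ?_
  rw [norm_mul, norm_mul, Complex.norm_exp_ofReal_mul_I, Complex.norm_exp_ofReal_mul_I]
  linarith

theorem differentiableAt_of_dbar_eq_zero {f : ℂ → ℂ} {z : ℂ} (hf : DifferentiableAt ℝ f z)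
    (h : dbar f z = 0) : DifferentiableAt ℂ f z := by
  refine differentiableAt_complex_iff_differentiableAt_real.2 ⟨hf, ?_⟩
  have h' : fderiv ℝ f z 1 + Complex.I * fderiv ℝ f z Complex.I = 0 := by
    simpa [dbar] using h
  rw [smul_eq_mul]
  linear_combination (-Complex.I) * h' + (fderiv ℝ f z Complex.I) * Complex.I_mul_I

/-- Cauchy estimates for `θ ↦ f (R cos θ)` at real points. -/
theorem norm_iteratedDeriv_comp_cos_le {f : ℂ → ℂ} {R ρ M : ℝ} (hR : 1 ≤ R) (hρ : 0 < ρ)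
    (hρ1 : ρ ≤ 1) {x : ℝ} {U : Set ℂ}
    (hf : ∀ z ∈ U, DifferentiableAt ℂ f z) (hU : Metric.closedBall (R * Complex.cos x) ρ ⊆ U)
    (hM : ∀ z ∈ Metric.closedBall (R * Complex.cos x) ρ, ‖f z‖ ≤ M) (j : ℕ) :
    ‖iteratedDeriv j (fun t : ℝ => f (R * Complex.cos t)) x‖ ≤
      j.factorial * M * (2 * R / ρ) ^ j := by
  -- On unit discs centred on the real line, cos at most doubles the distance to the centre, so w ↦
  -- R cos w maps the disc of radius ρ/(2R) into one of radius ρ.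
  have hr : 0 < ρ / (2 * R) := by positivity
  have hmem : ∀ w ∈ Metric.closedBall (x : ℂ) (ρ / (2 * R)),
      R * Complex.cos w ∈ Metric.closedBall (R * Complex.cos x) ρ := by
    intro w hw
    rw [mem_closedBall_iff_norm] at hw ⊢
    have h1 : ρ / (2 * R) ≤ 1 := by rw [div_le_one (by positivity)]; linarith
    rw [← mul_sub, norm_mul, Complex.norm_real, Real.norm_of_nonneg (by positivity)]
    calc R * ‖Complex.cos w - Complex.cos x‖ ≤ R * (2 * (ρ / (2 * R))) := by
          gcongr
          exact (norm_cos_sub_cos_le x (hw.trans h1)).trans (by gcongr)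
      _ = ρ := by field_simp
  have hd : ∀ w ∈ Metric.closedBall (x : ℂ) (ρ / (2 * R)),
      DifferentiableAt ℂ (fun w => f (R * Complex.cos w)) w := by
    intro w hw
    exact (hf _ (hU (hmem w hw))).comp w (by fun_prop)
  rw [iteratedDeriv_comp_ofReal (G := fun w => f (R * Complex.cos w)) Metric.isOpen_ball
    (fun w hw => (hd w (Metric.ball_subset_closedBall hw)).differentiableWithinAt) j
    (Metric.mem_ball_self hr)]
  refine (Complex.norm_iteratedDeriv_le_of_forall_mem_sphere_norm_le j hr (C := M) ?_ ?_).trans_eq ?_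
  · refine DifferentiableOn.diffContOnCl fun w hw => ?_
    exact (hd w (Metric.closure_ball_subset_closedBall hw)).differentiableWithinAt
  · exact fun z hz => hM _ (hmem z (Metric.sphere_subset_closedBall hz))
  · rw [div_eq_mul_inv, ← inv_pow, inv_div]

/-- Leibniz estimate for a product. -/
theorem norm_iteratedDeriv_mul_le_of_le {χ F : ℝ → ℂ} {k : ℕ} (hχ : ContDiff ℝ k χ)
    (hF : ContDiff ℝ k F) {q M : ℝ} {x : ℝ}
    (h1 : ∀ i ≤ k, ‖iteratedDeriv i χ x‖ ≤ q ^ i) (h2 : ∀ i ≤ k, ‖iteratedDeriv i F x‖ ≤ q ^ i * M)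
    (hq : 0 ≤ q) : ‖iteratedDeriv k (fun y => χ y * F y) x‖ ≤ (2 * q) ^ k * M := by
  have := norm_iteratedFDeriv_mul_le hχ hF x (n := k) le_rfl
  simp only [norm_iteratedFDeriv_eq_norm_iteratedDeriv] at this
  refine this.trans ?_
  rw [two_mul, add_pow, Finset.sum_mul]
  refine Finset.sum_le_sum fun i hi => ?_
  have hi' : i ≤ k := by simpa [Nat.lt_succ_iff] using hi
  calc _ ≤ (k.choose i : ℝ) * q ^ i * (q ^ (k - i) * M) := by
        gcongr
        · exact h1 i hi'
        · exact h2 _ (by omega)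
    _ = _ := by ring

/-! ### Truncated cosine series as polynomials -/

/-- The sum `∑ m ^ (-2)` over the nonzero integers. -/
def invSqSum : ℝ := ∑' m : ℤ, 1 / (m : ℝ) ^ 2

theorem invSqSum_nonneg : 0 ≤ invSqSum := tsum_nonneg fun _ => by positivity

/-- Truncating the cosine series of a function of `R cos θ` gives a polynomial approximation. -/
theorem polyDist_le_of_hasSum {E : Set ℝ} {R : ℝ} (hR : 0 < R) (hE : ∀ x ∈ E, |x| ≤ R)
    {f : ℂ → ℂ} {h : ℝ → ℂ} {a : ℤ → ℂ} {B : ℝ} {l n : ℕ} (hn : 1 ≤ n) (hB : 0 ≤ B)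
    (ha : ∀ m, m ≠ 0 → ‖a m‖ ≤ B / |(m : ℝ)| ^ (l + 2))
    (hs : ∀ θ : ℝ, HasSum (fun m : ℤ => a m * Complex.exp (m * θ * Complex.I)) (h θ))
    (hh : ∀ θ : ℝ, R * Real.cos θ ∈ E → h θ = f (R * Real.cos θ : ℝ)) :
    (n : ℝ≥0∞) ^ l * polyDist ((Complex.ofReal '' E).domRestrict f) n ≤
      ENNReal.ofReal (B * invSqSum) := by
  have hn0 : (0 : ℝ) < n := by exact_mod_cast hn
  set s : Finset ℤ := Finset.Icc (-n : ℤ) n with hsdef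
  set P : Polynomial ℂ := ∑ m ∈ s, Polynomial.C (a m) *
    (Polynomial.Chebyshev.T ℂ m).comp (Polynomial.C (R : ℂ)⁻¹ * Polynomial.X) with hP
  have hdeg : P.natDegree ≤ n := by
    refine Polynomial.natDegree_sum_le_of_forall_le _ _ fun m hm => ?_
    refine (Polynomial.natDegree_C_mul_le _ _).trans (Polynomial.natDegree_comp_le.trans ?_)
    rw [Polynomial.Chebyshev.natDegree_T]
    have h1 : (Polynomial.C (R : ℂ)⁻¹ * Polynomial.X).natDegree ≤ 1 :=
      (Polynomial.natDegree_C_mul_le _ _).trans Polynomial.natDegree_X_le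
    have h2 : m.natAbs ≤ n := by rw [hsdef, Finset.mem_Icc] at hm; omega
    calc _ ≤ n * 1 := Nat.mul_le_mul h2 h1
      _ = n := mul_one n
  have key : ∀ x ∈ E, ‖f x - P.eval (x : ℂ)‖ ≤ B / n ^ l * invSqSum := by
    intro x hx
    have hxR := abs_le.1 (hE x hx)
    set θ := Real.arccos (x / R) with hθ
    have hcos : R * Real.cos θ = x := by
      rw [hθ, Real.cos_arccos (by rw [le_div_iff₀ hR]; linarith) (by rw [div_le_one hR]; linarith)]
      field_simp
    have hev : P.eval (x : ℂ) = ∑ m ∈ s, a m * Complex.cos (m * θ) := by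
      rw [hP, Polynomial.eval_finsetSum]
      refine Finset.sum_congr rfl fun m _ => ?_
      rw [Polynomial.eval_mul, Polynomial.eval_C, Polynomial.eval_comp, Polynomial.eval_mul,
        Polynomial.eval_C, Polynomial.eval_X, ← Polynomial.Chebyshev.T_complex_cos, ← hcos]
      have : (R : ℂ) ≠ 0 := by exact_mod_cast hR.ne'
      push_cast
      rw [inv_mul_cancel_left₀ this]
    -- Averaging the expansions at θ and -θ, which have the same sum, turns exponentials into
    -- cosines without any symmetry of `a`.
    have h1 : HasSum (fun m : ℤ => a m * Complex.cos (m * θ)) (f x) := by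
      have e1 := hs θ
      have e2 := hs (-θ)
      rw [hh θ (by rwa [hcos]), hcos] at e1
      rw [hh (-θ) (by rwa [Real.cos_neg, hcos]), Real.cos_neg, hcos] at e2
      have e3 := (e1.add e2).div_const 2
      convert! e3 using 1
      · ext m
        rw [Complex.cos]
        push_cast
        ring_nf
      · ring
    have h2 : HasSum (fun m : ℤ => if m ∈ s then a m * Complex.cos (m * θ) else 0)
        (P.eval (x : ℂ)) := by
      rw [hev, ← Finset.sum_congr rfl fun m hm => if_pos hm]
      exact hasSum_sum_of_ne_finset_zero fun m hm => if_neg hm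
    have h3 := h1.sub h2
    rw [← h3.tsum_eq]
    -- Of the decay |m|^(-(l+2)), l powers yield n^(-l) and two are kept for summability. The term m
    -- = 0 of the series is 0, as 1 / 0 = 0.
    have h4 : HasSum (fun m : ℤ => B / n ^ l * (1 / (m : ℝ) ^ 2)) (B / n ^ l * invSqSum) :=
      (Real.summable_one_div_int_pow.2 one_lt_two).hasSum.mul_left _
    refine tsum_of_norm_bounded h4 fun m => ?_
    by_cases hm : m ∈ s
    · simp only [if_pos hm, sub_self, norm_zero]
      positivity
    · have hm1 : (n : ℤ) ≤ |m| := by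
        by_contra hlt
        exact hm (Finset.mem_Icc.2 (abs_le.1 (not_le.1 hlt).le))
      have hm2 : (n : ℝ) ≤ |(m : ℝ)| := by exact_mod_cast hm1
      have hm0 : m ≠ 0 := by
        rintro rfl
        simp at hm1
        omega
      have hpos : 0 < |(m : ℝ)| := by positivity
      rw [if_neg hm, sub_zero, norm_mul]
      have hc : ‖Complex.cos (m * θ)‖ ≤ 1 := by
        have : Complex.cos (m * θ) = (Real.cos (m * θ) : ℝ) := by push_cast; rfl
        rw [this, Complex.norm_real]
        exact Real.abs_cos_le_one _
      calc _ ≤ B / |(m : ℝ)| ^ (l + 2) * 1 := by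
            gcongr
            exact ha m hm0
        _ = B / |(m : ℝ)| ^ l * (1 / |(m : ℝ)| ^ 2) := by rw [pow_add]; field_simp
        _ ≤ _ := by
            rw [sq_abs]
            gcongr
  have hD : polyDist ((Complex.ofReal '' E).domRestrict f) n ≤
      ENNReal.ofReal (B / n ^ l * invSqSum) := by
    refine iInf₂_le_of_le P hdeg (iSup_le ?_)
    rintro ⟨_, x, hx, rfl⟩
    rw [← ofReal_norm]
    exact ENNReal.ofReal_le_ofReal (key x hx)
  calc _ ≤ (n : ℝ≥0∞) ^ l * ENNReal.ofReal (B / n ^ l * invSqSum) := by gcongr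
    _ = _ := by
      rw [← ENNReal.ofReal_natCast n, ← ENNReal.ofReal_pow (by positivity),
        ← ENNReal.ofReal_mul (by positivity)]
      congr 1
      field_simp

/-! ### Cutoff and the approximation bound in each degree -/

/-- A continuous cutoff, equal to `1` at distance at most `ρ` from `E` and vanishing at distance
at least `2ρ`. -/
def cutoff (E : Set ℂ) (ρ : ℝ) (z : ℂ) : ℝ := max 0 (min 1 (2 - Metric.infDist z E / ρ))

theorem continuous_cutoff (E : Set ℂ) (ρ : ℝ) : Continuous (cutoff E ρ) := by
  have := Metric.continuous_infDist_pt E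
  unfold cutoff
  fun_prop

theorem abs_cutoff_le_one (E : Set ℂ) (ρ : ℝ) (z : ℂ) : |cutoff E ρ z| ≤ 1 := by
  rw [abs_of_nonneg (le_max_left _ _)]
  exact max_le zero_le_one (min_le_left _ _)

theorem cutoff_eq_one {E : Set ℂ} {ρ : ℝ} (hρ : 0 < ρ) {z : ℂ} (h : Metric.infDist z E ≤ ρ) :
    cutoff E ρ z = 1 := by
  have : Metric.infDist z E / ρ ≤ 1 := (div_le_one hρ).2 h
  rw [cutoff, min_eq_left (by linarith), max_eq_right zero_le_one]

theorem cutoff_eq_zero {E : Set ℂ} {ρ : ℝ} (hρ : 0 < ρ) {z : ℂ}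
    (h : 2 * ρ ≤ Metric.infDist z E) : cutoff E ρ z = 0 := by
  have : 2 ≤ Metric.infDist z E / ρ := (le_div_iff₀ hρ).2 h
  exact max_eq_left ((min_le_right _ _).trans (by linarith))

theorem infDist_mul_cos_le {E : Set ℂ} {R ρ : ℝ} (hR : 0 ≤ R) {x y : ℝ} (h : R * |y - x| ≤ ρ) :
    Metric.infDist (R * Complex.cos y) E ≤ Metric.infDist (R * Complex.cos x) E + ρ := by
  refine (Metric.infDist_le_infDist_add_dist (y := (R * Complex.cos x : ℂ))).trans ?_
  gcongr
  rw [dist_eq_norm, ← mul_sub, ← Complex.ofReal_cos, ← Complex.ofReal_cos, ← Complex.ofReal_sub,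
    ← Complex.ofReal_mul, Complex.norm_real, norm_mul, Real.norm_of_nonneg hR]
  exact (mul_le_mul_of_nonneg_left (Real.abs_cos_sub_cos_le y x) hR).trans h

theorem polyDist_le_of_smoothHolomorphicNear {E : Set ℝ} (hne : E.Nonempty) {R : ℝ} (hR : 1 ≤ R)
    (hE : ∀ x ∈ E, |x| ≤ R) {l n : ℕ} (hn : 1 ≤ n) {δ : ℝ} (hδ : 0 < δ) (hδ1 : δ ≤ 1)
    {f : ℂ → ℂ} (hf : f ∈ smoothHolomorphicNear (Metric.cthickening δ (Complex.ofReal '' E)))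
    {M : ℝ} (hM : ∀ z ∈ Metric.cthickening δ (Complex.ofReal '' E), ‖f z‖ ≤ M) :
    (n : ℝ≥0∞) ^ l * polyDist ((Complex.ofReal '' E).domRestrict f) n ≤
      ENNReal.ofReal ((16 * R * (l + 2 : ℕ) / δ) ^ (l + 2) * M * invSqSum) := by
  set K : Set ℂ := Complex.ofReal '' E with hK
  have hKne : K.Nonempty := hne.image _
  obtain ⟨hsm, U, hUo, hKU, hU⟩ := hf
  set k := l + 2 with hk
  have hk0 : (0 : ℝ) < k := by positivity
  -- The raw cutoff vanishes beyond 2ρ, averaging spreads it to 3ρ, and a Cauchy disc adds another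
  -- ρ: 4ρ = δ in all.
  set ρ := δ / 4 with hρ
  have hρ0 : 0 < ρ := by positivity
  -- With this scale, k averagings move R cos θ by at most ρ.
  set η := ρ / (R * k) with hη
  have hη0 : 0 < η := by positivity
  have hkη : R * (k * η) = ρ := by rw [hη]; field_simp
  set u : ℝ → ℂ := fun θ => (cutoff K ρ (R * Complex.cos θ) : ℂ) with hu
  have huc : Continuous u := by
    have := continuous_cutoff K ρ
    fun_prop
  have hu1 : ∀ θ, ‖u θ‖ ≤ 1 := fun θ => by
    rw [hu, Complex.norm_real]
    exact abs_cutoff_le_one _ _ _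
  set χ := (avg η)^[k] u with hχ
  have hstep : ∀ {x y : ℝ}, |y - x| ≤ k * η → R * |y - x| ≤ ρ := fun h => by
    rw [← hkη]; gcongr
  have hχ1 : ∀ x : ℝ, (R * Complex.cos x : ℂ) ∈ K → χ x = 1 := fun x hx => by
    refine avg_iterate_eq_of_forall hη0 k fun y hy => ?_
    have := infDist_mul_cos_le (E := K) (by linarith) (hstep hy)
    rw [Metric.infDist_zero_of_mem hx, zero_add] at this
    simp only [hu, cutoff_eq_one hρ0 this, Complex.ofReal_one]
  have hχ0 : ∀ x : ℝ, 3 * ρ ≤ Metric.infDist (R * Complex.cos x) K → χ x = 0 := fun x hx => by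
    refine avg_iterate_eq_of_forall hη0 k fun y hy => ?_
    rw [abs_sub_comm] at hy
    have := infDist_mul_cos_le (E := K) (by linarith) (hstep hy)
    simp only [hu, cutoff_eq_zero hρ0 (show 2 * ρ ≤ _ by linarith), Complex.ofReal_zero]
  have hχs : ContDiff ℝ k χ := contDiff_avg_iterate huc k
  set F : ℝ → ℂ := fun θ => f (R * Complex.cos θ) with hF
  have hFs : ContDiff ℝ k F := by
    have h1 : ContDiff ℝ k fun θ : ℝ => (R * Complex.cos θ : ℂ) :=
      contDiff_const.mul ((Complex.contDiff_cos.restrict_scalars ℝ).comp Complex.ofRealCLM.contDiff)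
    exact (hsm.of_le (by exact_mod_cast le_top)).comp h1
  have hM0 : 0 ≤ M := by
    obtain ⟨z, hz⟩ := hKne
    exact (norm_nonneg _).trans (hM z (Metric.self_subset_cthickening _ hz))
  -- Dominates both η⁻¹ = 4Rk/δ and the Cauchy rate k · 2R/ρ = 8Rk/δ, where i! ≤ k^i is used.
  set q := 8 * R * k / δ with hq
  have hq0 : 0 ≤ q := by positivity
  have hbound : ∀ x, ‖iteratedDeriv k (fun y => χ y * F y) x‖ ≤ (2 * q) ^ k * M := by
    intro x
    -- Far from E the product is locally zero, so f needs no bound there.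
    rcases lt_or_ge (3 * ρ) (Metric.infDist (R * Complex.cos x) K) with hx | hx
    · have h0 : (fun y => χ y * F y) =ᶠ[𝓝 x] fun _ => 0 := by
        have hc : Continuous fun y : ℝ => Metric.infDist (R * Complex.cos y) K := by
          have := Metric.continuous_infDist_pt K
          fun_prop
        filter_upwards [hc.continuousAt.eventually (lt_mem_nhds hx)] with y hy
        rw [hχ0 y hy.le, zero_mul]
      rw [h0.iteratedDeriv_eq, iteratedDeriv_fun_const_zero, norm_zero]
      positivity
    · have hsub : Metric.closedBall (R * Complex.cos x) ρ ⊆ Metric.cthickening δ K := by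
        intro z hz
        have h1 : Metric.infDist z K ≤ δ := by
          have h2 : Metric.infDist z K ≤ Metric.infDist (R * Complex.cos x) K + _ :=
            Metric.infDist_le_infDist_add_dist
          rw [Metric.mem_closedBall] at hz
          linarith
        rw [Metric.mem_cthickening_iff, ENNReal.le_ofReal_iff_toReal_le
          (Metric.infEDist_ne_top hKne) hδ.le]
        exact h1
      refine norm_iteratedDeriv_mul_le_of_le hχs hFs (fun i hi => ?_) (fun i hi => ?_) hq0
      · have h1 := norm_iteratedDeriv_avg_iterate_le hη0 huc hu1 k hi x
        rw [mul_one] at h1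
        refine h1.trans (pow_le_pow_left₀ (by positivity) ?_ _)
        rw [hη, hρ, hq, inv_div, div_div_eq_mul_div]
        gcongr ?_ / _
        nlinarith
      · have h1 := norm_iteratedDeriv_comp_cos_le hR hρ0 (by linarith)
          (fun z hz => differentiableAt_of_dbar_eq_zero
            (hsm.differentiable (by simp)).differentiableAt (hU z hz)) (hsub.trans hKU)
          (fun z hz => hM z (hsub hz)) i
        have h2 : (i.factorial : ℝ) ≤ (k : ℝ) ^ i := by
          exact_mod_cast (Nat.factorial_le_pow i).trans (Nat.pow_le_pow_left hi i)
        calc _ ≤ _ := h1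
          _ ≤ (k : ℝ) ^ i * M * (2 * R / ρ) ^ i := by gcongr
          _ = (k * (2 * R / ρ)) ^ i * M := by rw [mul_pow]; ring
          _ = q ^ i * M := by
            congr 2
            rw [hq, hρ]
            field_simp
            ring
  have hper : Function.Periodic (fun y => χ y * F y) (2 * Real.pi) := by
    have h1 : Function.Periodic u (2 * Real.pi) := fun x => by
      simp only [hu, Complex.ofReal_add, Complex.ofReal_mul, Complex.ofReal_ofNat,
        Complex.cos_add_two_pi]
    intro x
    have h2 := periodic_avg_iterate (η := η) h1 k x
    simp only [hF, Complex.ofReal_add, Complex.ofReal_mul, Complex.ofReal_ofNat,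
      Complex.cos_add_two_pi]
    rw [← hχ] at h2
    rw [h2]
  obtain ⟨a, ha, hs⟩ := exists_hasSum_fourier hper (by omega) (hχs.mul hFs) hbound
  refine (polyDist_le_of_hasSum (by linarith) hE hn (by positivity) ha hs (f := f) ?_).trans_eq ?_
  · intro θ hθ
    have : (R * Complex.cos θ : ℂ) ∈ K := ⟨_, hθ, by push_cast; rfl⟩
    simp only [hχ1 θ this, one_mul, hF]
    push_cast
    rfl
  · congr 3
    rw [hq]
    ring

/-! ### Jackson norms and constants -/

theorem supNorm_domRestrict_lt_top {K : Set ℂ} (hK : IsCompact K) {f : ℂ → ℂ}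
    (hf : Continuous f) : supNorm (K.domRestrict f) < ⊤ := by
  obtain ⟨C, hC⟩ := hK.exists_bound_of_continuousOn hf.continuousOn
  refine (iSup_le fun z => ?_ : _ ≤ ENNReal.ofReal C).trans_lt ENNReal.ofReal_lt_top
  rw [← ofReal_norm]
  exact ENNReal.ofReal_le_ofReal (hC z z.2)

theorem jacksonNorm_le_of_smoothHolomorphicNear {E : Set ℝ} (hc : IsCompact E)
    (hne : E.Nonempty) {R : ℝ} (hR : 1 ≤ R)
    (hE : ∀ x ∈ E, |x| ≤ R) {l : ℕ} {δ : ℝ} (hδ : 0 < δ) (hδ1 : δ ≤ 1)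
    {f : ℂ → ℂ} (hf : f ∈ smoothHolomorphicNear (Metric.cthickening δ (Complex.ofReal '' E))) :
    jacksonNorm l ((Complex.ofReal '' E).domRestrict f) ≤
      ENNReal.ofReal (1 + invSqSum * (16 * R * (l + 2 : ℕ) / δ) ^ (l + 2)) *
        supNorm ((Metric.cthickening δ (Complex.ofReal '' E)).domRestrict f) := by
  set K : Set ℂ := Complex.ofReal '' E with hK
  have hKc : IsCompact K := hc.image Complex.continuous_ofReal
  set N := supNorm ((Metric.cthickening δ K).domRestrict f) with hN
  have hle : ∀ z ∈ Metric.cthickening δ K, ‖f z‖ₑ ≤ N := fun z hz =>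
    le_iSup (fun x : Metric.cthickening δ K => ‖(Metric.cthickening δ K).domRestrict f x‖ₑ) ⟨z, hz⟩
  have hNtop : N < ⊤ := supNorm_domRestrict_lt_top hKc.cthickening hf.1.continuous
  have hM : ∀ z ∈ Metric.cthickening δ K, ‖f z‖ ≤ N.toReal := fun z hz => by
    rw [← toReal_enorm]
    exact ENNReal.toReal_mono hNtop.ne (hle z hz)
  have h1 : supNorm (K.domRestrict f) ≤ N := iSup_le fun z =>
    hle z (Metric.self_subset_cthickening _ z.2)
  have h0 := invSqSum_nonneg
  rw [ENNReal.ofReal_add zero_le_one (by positivity), ENNReal.ofReal_one, add_mul, one_mul]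
  refine add_le_add h1 (iSup₂_le fun n hn => ?_)
  refine (polyDist_le_of_smoothHolomorphicNear hne hR hE hn hδ hδ1 hf hM).trans_eq ?_
  rw [← ENNReal.ofReal_toReal hNtop.ne, ← ENNReal.ofReal_mul (by positivity),
    ENNReal.toReal_ofReal ENNReal.toReal_nonneg]
  congr 1
  ring

theorem exists_one_le_forall_abs_le {E : Set ℝ} (hE : IsCompact E) :
    ∃ R : ℝ, 1 ≤ R ∧ ∀ x ∈ E, |x| ≤ R := by
  obtain ⟨C, hC⟩ := hE.exists_bound_of_continuousOn continuousOn_id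
  exact ⟨max 1 C, le_max_left _ _, fun x hx => (hC x hx).trans (le_max_right _ _)⟩

theorem jacksonEstimate_one_six {E : Set ℝ} (hE : IsCompact E) :
    JacksonEstimate (Complex.ofReal '' E) 1 6 := by
  obtain ⟨R, hR, hER⟩ := exists_one_le_forall_abs_le hE
  have hS := invSqSum_nonneg
  -- 48R comes from 16R(l + 2) ≤ 48Rl; `invSqSum` lets one extra factor of the base absorb 1 +
  -- `invSqSum`; 3 makes l + 3 ≤ l + c.
  set c : ℝ := 48 * R + invSqSum + 3 with hc
  have hc3 : 3 ≤ c := by linarith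
  refine ⟨c, by linarith, fun l hl δ hδ hδ1 f hf => ?_⟩
  rcases E.eq_empty_or_nonempty with rfl | hne
  · have : IsEmpty (Complex.ofReal '' (∅ : Set ℝ)) := by simp
    have h0 : ∀ g : (Complex.ofReal '' (∅ : Set ℝ)) → ℂ, supNorm g = 0 := fun g => by
      simp [supNorm]
    have h1 : ∀ (g : (Complex.ofReal '' (∅ : Set ℝ)) → ℂ) n, polyDist g n = 0 := fun g n =>
      le_antisymm (iInf₂_le_of_le 0 (by simp) (h0 _).le) zero_le
    simp [jacksonNorm, h0, h1]
  refine (jacksonNorm_le_of_smoothHolomorphicNear hE hne hR hER hδ hδ1 hf).trans ?_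
  gcongr
  have hl1 : (1 : ℝ) ≤ l := by exact_mod_cast hl
  set b := c * (l : ℝ) ^ (6 : ℝ) / δ ^ (1 : ℝ) with hb
  -- The argument gives linear growth in l; the exponent 6 enters only through this weakening.
  have hlpow : (l : ℝ) ≤ (l : ℝ) ^ (6 : ℝ) := by
    simpa using Real.rpow_le_rpow_of_exponent_le hl1 (show (1 : ℝ) ≤ 6 by norm_num)
  have hbc : c * l / δ ≤ b := by
    rw [hb, Real.rpow_one]
    gcongr
  have hcb : c ≤ c * l / δ := by
    rw [le_div_iff₀ hδ]
    gcongr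
    linarith
  have hb1 : 1 ≤ b := by linarith
  have h1 : 16 * R * (l + 2 : ℕ) / δ ≤ b := by
    refine le_trans ?_ hbc
    gcongr ?_ / _
    push_cast
    calc 16 * R * ((l : ℝ) + 2) ≤ 16 * R * (3 * l) := by gcongr; linarith
      _ = (48 * R) * l := by ring
      _ ≤ c * l := by gcongr; linarith
  calc 1 + invSqSum * (16 * R * (l + 2 : ℕ) / δ) ^ (l + 2)
      ≤ 1 * b ^ (l + 2) + invSqSum * b ^ (l + 2) := by
        gcongr
        rw [one_mul]
        exact one_le_pow₀ hb1
    _ = (1 + invSqSum) * b ^ (l + 2) := by ring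
    _ ≤ b * b ^ (l + 2) := by gcongr; linarith
    _ = b ^ ((l : ℝ) + 3) := by
        rw [← pow_succ', ← Real.rpow_natCast]
        congr 1
        push_cast
        ring
    _ ≤ b ^ ((l : ℝ) + c) := Real.rpow_le_rpow_of_exponent_le hb1 (by linarith)

/-! ### Rapid approximation of germs -/

theorem domRestrict_mem_rapidlyApproximable {E : Set ℝ} (hE : IsCompact E) {f : ℂ → ℂ}
    (hf : f ∈ smoothHolomorphicNear (Complex.ofReal '' E)) :
    (Complex.ofReal '' E).domRestrict f ∈ rapidlyApproximable (Complex.ofReal '' E) := by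
  obtain ⟨hsm, U, hUo, hEU, hU⟩ := hf
  refine ⟨hsm.continuous.comp continuous_subtype_val, fun l _ => ?_⟩
  set g := (Complex.ofReal '' E).domRestrict f with hg
  -- A finite norm of order l + 1 bounds the order-l sequence by C / n, hence gives limit 0.
  obtain ⟨C, hC, hle⟩ : ∃ C : ℝ≥0∞, C ≠ ⊤ ∧ jacksonNorm (l + 1) g ≤ C := by
    obtain ⟨R, hR, hER⟩ := exists_one_le_forall_abs_le hE
    obtain ⟨ε, hε, hεU⟩ :=
      (hE.image Complex.continuous_ofReal).exists_cthickening_subset_open hUo hEU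
    have hmem : f ∈ smoothHolomorphicNear
        (Metric.cthickening (min ε 1) (Complex.ofReal '' E)) :=
      ⟨hsm, U, hUo, (Metric.cthickening_mono (min_le_left _ _) _).trans hεU, hU⟩
    obtain ⟨c, -, hc⟩ := jacksonEstimate_one_six hE
    refine ⟨_, ?_, hc (l + 1) (by omega) (min ε 1) (by positivity) (min_le_right _ _) f hmem⟩
    exact ENNReal.mul_ne_top ENNReal.ofReal_ne_top (supNorm_domRestrict_lt_top
      (hE.image Complex.continuous_ofReal).cthickening hsm.continuous).ne
  have hlim : Filter.Tendsto (fun n : ℕ => C / (n : ℝ≥0∞)) Filter.atTop (𝓝 0) := by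
    have := ENNReal.Tendsto.const_mul (a := C) ENNReal.tendsto_inv_nat_nhds_zero (Or.inr hC)
    simpa [div_eq_mul_inv] using this
  refine tendsto_of_tendsto_of_tendsto_of_le_of_le' tendsto_const_nhds hlim
    (Filter.Eventually.of_forall fun _ => zero_le) ?_
  filter_upwards [Filter.eventually_ge_atTop 1] with n hn
  have hn0 : (n : ℝ≥0∞) ≠ 0 := by simp; omega
  rw [ENNReal.le_div_iff_mul_le (Or.inl hn0) (Or.inl (ENNReal.natCast_ne_top n))]
  have h1 : (n : ℝ≥0∞) ^ (l + 1) * polyDist g n ≤ jacksonNorm (l + 1) g :=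
    le_add_left (le_iSup₂ (f := fun (n : ℕ) (_ : n ∈ {n : ℕ | 1 ≤ n}) =>
      (n : ℝ≥0∞) ^ (l + 1) * polyDist g n) n hn)
  calc _ = (n : ℝ≥0∞) ^ (l + 1) * polyDist g n := by ring
    _ ≤ C := h1.trans hle

end Jackson

end

/-- Every compact set of real numbers, seen in the complex plane, admits the Jackson Property
`JP(1)`, and the exponent `v = 6` is admissible in it. -/
theorem proposition4p1 (E : Set ℝ) (hE : IsCompact E) :
    Jackson.JacksonProperty (Complex.ofReal '' E) 1 ∧
      Jackson.JacksonEstimate (Complex.ofReal '' E) 1 6 := by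
  have h := Jackson.jacksonEstimate_one_six hE
  refine ⟨⟨?_, 6, by norm_num, h⟩, h⟩
  rintro _ ⟨f, hf, rfl⟩
  exact Jackson.domRestrict_mem_rapidlyApproximable hE hf
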